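/- Let $n,d$ be integers with $d\ge 2$ and $n\ge 2d$. Let $J(n,d)$ be the Johnson graph: its vertices are the $d$-subsets of $\{1,\dots,n\}$, and two of them are adjacent when their intersection has size $d-1$. For a finite simple graph $G$, let $\mathcal S(G)$ be the set of all real symmetric matrices $A=(a_{uv})$ with rows and columns indexed by the vertices of $G$ such that, for all $u\neq v$, $a_{uv}=0$ if and only if $\{u,v\}$ is not an edge of $G$ (the diagonal entries are arbitrary). Put $$mr(G)=\min\{\operatorname{rank} M : M\in\mathcal S(G)\},\qquad mr_+(G)=\min\{\operatorname{rank} M : M\in\mathcal S(G),\ M \text{ positive semidefinite}\}.$$ Then $$mr(J(n,d)) = mr_+(J(n,d)) = \binom{n-2}{d-1}.$$ -/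

import Mathlib

/-- The Johnson graph `J(n,d)`: the vertices are the `d`-subsets of an `n`-element set, and two of
them are adjacent when their intersection has `d - 1` elements (written without subtraction). -/
def johnsonGraph (n d : ℕ) : SimpleGraph {s : Finset (Fin n) // s.card = d} where
  Adj s t := (s.1 ∩ t.1).card + 1 = d
  symm := ⟨fun s t h => by rwa [Finset.inter_comm]⟩
  loopless := ⟨fun s h => by
    have hs := s.2
    rw [Finset.inter_self] at h
    omega⟩

/-- The set `𝒮(G)` of real symmetric matrices whose off-diagonal zero pattern is that of `G`; the
diagonal entries are arbitrary. -/
def graphMatrices {V : Type*} (G : SimpleGraph V) : Set (Matrix V V ℝ) :=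
  {A | A.IsSymm ∧ ∀ i j, i ≠ j → (A i j = 0 ↔ ¬ G.Adj i j)}

/-- The minimum rank of a matrix in `𝒮(G)`. -/
noncomputable def minRank {V : Type*} [Fintype V] (G : SimpleGraph V) : ℕ :=
  sInf {r : ℕ | ∃ M ∈ graphMatrices G, M.rank = r}

/-- The minimum rank of a positive semidefinite matrix in `𝒮(G)`. -/
noncomputable def minRankPSD {V : Type*} [Fintype V] (G : SimpleGraph V) : ℕ :=
  sInf {r : ℕ | ∃ M ∈ graphMatrices G, M.PosSemidef ∧ M.rank = r}

/-!
**Lower bound.** Fix `z ≠ w`. For `(d - 1)`-sets `T`, `U` avoiding both, `T ∪ {z}` and `U ∪ {w}`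
meet in `T ∩ U`, so they are adjacent exactly when `T = U`. Every matrix in `𝒮(J(n,d))` therefore
has an invertible diagonal submatrix of order `C(n - 2, d - 1)`
(`choose_le_rank_of_mem_graphMatrices`).

**Upper bound.** Fix `z`, and let `D` be the contraction by `∑ i ≠ z, e_i` on the exterior
algebra of `ℝⁿ`, a matrix indexed by the subsets of `Fin n`. Then `D * D = 0` and
`D * Dᵀ + Dᵀ * D = (n - 1) • 1` (`contraction_mul_self`, `contraction_laplacian`). To a
`d`-subset `S` attach the vector `x_S = D e_S` if `z ∉ S`, and `x_S = D Dᵀ e_{S \ {z}}` if `z ∈ S`.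
The two identities reduce the Gram matrix of the `x_S`, up to nonzero factors, to entries of `D`
and `Dᵀ * D`, which vanish off the diagonal exactly at the nonadjacent pairs
(`johnsonVectors_gram_mem_graphMatrices`). All `x_S` are killed by `D` and supported on
`(d - 1)`-subsets avoiding `z`; an element of `ker D` is determined by its coordinates at the sets
avoiding a further point `w`, because the kernel equation at `T \ {w}` expresses the coordinate at
`T ∋ w` through these. Hence the Gram matrix has rank at most `C(n - 2, d - 1)`
(`rank_johnsonVectors_le`).

Geometrically, for a null vector `ℓ` with nonzero coordinates in Lorentz space of dimension `n`,
these are, up to scaling, the contractions of the `e_S` by `ℓ`, read in `Λ^(d-1)(ℓ^⊥ / ℓ)`, where `ℓ^⊥ / ℓ` is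
Euclidean of dimension `n - 2`.
-/

open Matrix

/-! ### Annihilation operators on the exterior algebra -/

/-- The sign `(-1) ^ #{j ∈ S | j < i}` with which `i` moves to its place in the increasing
enumeration of `S`. Whether `i` itself belongs to `S` does not matter. -/
def jwSign {n : ℕ} (i : Fin n) (S : Finset (Fin n)) : ℝ := ∏ j ∈ S, if j < i then -1 else 1

lemma jwSign_mul_self {n : ℕ} (i : Fin n) (S : Finset (Fin n)) : jwSign i S * jwSign i S = 1 := by
  rw [jwSign, ← Finset.prod_mul_distrib]
  exact Finset.prod_eq_one fun j _ => by split_ifs <;> norm_num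

lemma jwSign_ne_zero {n : ℕ} (i : Fin n) (S : Finset (Fin n)) : jwSign i S ≠ 0 := fun h => by
  simpa [h] using jwSign_mul_self i S

lemma jwSign_insert {n : ℕ} {i j : Fin n} {S : Finset (Fin n)} (h : j ∉ S) :
    jwSign i (insert j S) = (if j < i then -1 else 1) * jwSign i S :=
  Finset.prod_insert h

/-- Contraction by the `i`-th basis vector of the exterior algebra, in the monomial basis `e_S`
indexed by subsets `S`: it sends `e_S` to `± e_{S \ {i}}` if `i ∈ S` and to `0` otherwise. -/
def annihilation {n : ℕ} (i : Fin n) : Matrix (Finset (Fin n)) (Finset (Fin n)) ℝ :=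
  Matrix.of fun T S => if i ∉ T ∧ insert i T = S then jwSign i T else 0

lemma annihilation_apply {n : ℕ} (i : Fin n) (T S : Finset (Fin n)) :
    annihilation i T S = if i ∉ T ∧ insert i T = S then jwSign i T else 0 := rfl

lemma annihilation_mul_apply {n : ℕ} {κ : Type*} (i : Fin n) (N : Matrix (Finset (Fin n)) κ ℝ)
    (T : Finset (Fin n)) (k : κ) :
    (annihilation i * N) T k = if i ∈ T then 0 else jwSign i T * N (insert i T) k := by
  rw [Matrix.mul_apply, Finset.sum_eq_single (insert i T)]
  · by_cases h : i ∈ T <;> simp [annihilation_apply, h]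
  · intro S _ hS
    simp [annihilation_apply, hS.symm]
  · simp

lemma annihilation_transpose_mul_apply {n : ℕ} {κ : Type*} (i : Fin n)
    (N : Matrix (Finset (Fin n)) κ ℝ) (S : Finset (Fin n)) (k : κ) :
    ((annihilation i).transpose * N) S k =
      if i ∈ S then jwSign i (S.erase i) * N (S.erase i) k else 0 := by
  rw [Matrix.mul_apply, Finset.sum_eq_single (S.erase i)]
  · by_cases h : i ∈ S <;> simp [annihilation_apply, h]
  · intro T _ hT
    rw [Matrix.transpose_apply, annihilation_apply, if_neg, zero_mul]
    rintro ⟨h1, rfl⟩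
    exact hT (Finset.erase_insert h1).symm
  · simp

lemma annihilation_anticomm {n : ℕ} (i j : Fin n) :
    annihilation i * annihilation j + annihilation j * annihilation i = 0 := by
  ext R S
  rw [Matrix.add_apply, annihilation_mul_apply, annihilation_mul_apply, annihilation_apply,
    annihilation_apply, Matrix.zero_apply]
  rcases eq_or_ne i j with rfl | hij
  · simp
  by_cases hi : i ∈ R
  · simp [hi]
  by_cases hj : j ∈ R
  · simp [hj]
  rw [Finset.insert_comm j i R]
  by_cases hS : insert i (insert j R) = S
  · simp only [hi, hj, hS, Finset.mem_insert, hij, hij.symm, jwSign_insert hi, jwSign_insert hj]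
    rcases lt_or_gt_of_ne hij with h | h
    · simp [h, h.not_gt]; ring
    · simp [h, h.not_gt]; ring
  · simp [hS]

lemma annihilation_anticomm_transpose_self {n : ℕ} (i : Fin n) :
    annihilation i * (annihilation i).transpose + (annihilation i).transpose * annihilation i
      = 1 := by
  ext R S
  rw [Matrix.add_apply, annihilation_mul_apply, annihilation_transpose_mul_apply,
    annihilation_apply, Matrix.transpose_apply, annihilation_apply, Matrix.one_apply]
  by_cases hi : i ∈ R
  · simp only [hi, if_true, zero_add, Finset.notMem_erase, not_false_eq_true, true_and,
      Finset.insert_erase hi]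
    split_ifs <;> simp [jwSign_mul_self]
  · simp only [hi, if_false, add_zero]
    by_cases hS : R = S
    · subst hS
      simp [hi, jwSign_mul_self]
    · rw [if_neg, if_neg hS, mul_zero]
      rintro ⟨h1, h2⟩
      apply hS
      rw [← Finset.erase_insert h1, h2, Finset.erase_insert hi]

lemma annihilation_anticomm_transpose {n : ℕ} {i j : Fin n} (hij : i ≠ j) :
    annihilation i * (annihilation j).transpose + (annihilation j).transpose * annihilation i
      = 0 := by
  ext R S
  rw [Matrix.add_apply, annihilation_mul_apply, annihilation_transpose_mul_apply,
    annihilation_apply, Matrix.transpose_apply, annihilation_apply, Matrix.zero_apply]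
  by_cases hi : i ∈ R
  · simp [hi, hij]
  by_cases hj : j ∈ R
  swap
  · have : ¬ (j ∉ S ∧ insert j S = insert i R) := by
      rintro ⟨-, h⟩
      have : j ∈ insert i R := h ▸ Finset.mem_insert_self j S
      simp [hij.symm, hj] at this
    simp [hj, this]
  obtain ⟨Q, hQ, rfl⟩ : ∃ Q, j ∉ Q ∧ insert j Q = R :=
    ⟨R.erase j, Finset.notMem_erase _ _, Finset.insert_erase hj⟩
  have hiQ : i ∉ Q := fun h => hi (Finset.mem_insert_of_mem h)
  have key : (j ∉ S ∧ insert j S = insert i (insert j Q)) ↔ insert i Q = S := by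
    constructor
    · rintro ⟨h1, h2⟩
      rw [← Finset.erase_insert h1, h2, Finset.insert_comm, Finset.erase_insert]
      simp [hij.symm, hQ]
    · rintro rfl
      exact ⟨by simp [hij.symm, hQ], Finset.insert_comm _ _ _⟩
  simp only [key, Finset.erase_insert hQ, hi, hiQ, Finset.mem_insert_self, if_true, if_false,
    not_false_eq_true, true_and]
  by_cases hS : insert i Q = S
  · subst hS
    rw [jwSign_insert hiQ, jwSign_insert hQ]
    rcases lt_or_gt_of_ne hij with h | h
    · simp [h, h.not_gt]; ring
    · simp [h, h.not_gt]; ring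
  · simp [hS]

/-! ### Contraction by a sum of basis vectors -/

/-- Contraction by `∑ i ∈ I, e_i` on the exterior algebra, as a matrix indexed by subsets: the
boundary operator of the full simplex, with the summands outside `I` deleted. -/
def contraction {n : ℕ} (I : Finset (Fin n)) : Matrix (Finset (Fin n)) (Finset (Fin n)) ℝ :=
  ∑ i ∈ I, annihilation i

lemma contraction_mul_self {n : ℕ} (I : Finset (Fin n)) : contraction I * contraction I = 0 := by
  have h : contraction I * contraction I + contraction I * contraction I = 0 := by
    simp only [contraction, Finset.sum_mul_sum]
    nth_rewrite 2 [Finset.sum_comm]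
    simp only [← Finset.sum_add_distrib, annihilation_anticomm, Finset.sum_const_zero]
  rw [← two_smul ℝ] at h
  exact (smul_eq_zero.1 h).resolve_left two_ne_zero

/-- The Laplacian of the contraction is scalar: the mixed terms cancel by anticommutation. -/
lemma contraction_laplacian {n : ℕ} (I : Finset (Fin n)) :
    contraction I * (contraction I)ᵀ + (contraction I)ᵀ * contraction I = (I.card : ℝ) • 1 := by
  simp only [contraction, Matrix.transpose_sum, Finset.sum_mul_sum]
  nth_rewrite 2 [Finset.sum_comm]
  simp only [← Finset.sum_add_distrib]
  rw [Finset.sum_congr rfl fun i hi => (Finset.sum_eq_single_of_mem i hi fun j _ hj =>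
    annihilation_anticomm_transpose hj.symm).trans (annihilation_anticomm_transpose_self i)]
  simp [Nat.cast_smul_eq_nsmul]

lemma contraction_apply_insert {n : ℕ} {I T : Finset (Fin n)} {i : Fin n} (hi : i ∈ I)
    (hT : i ∉ T) : contraction I T (insert i T) = jwSign i T := by
  rw [contraction, Matrix.sum_apply, Finset.sum_eq_single_of_mem i hi]
  · simp [annihilation_apply, hT]
  · intro j _ hj
    rw [annihilation_apply, if_neg]
    rintro ⟨h1, h2⟩
    have : j ∈ insert i T := h2 ▸ Finset.mem_insert_self j T
    simp [hj, h1] at this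

lemma contraction_ne_zero_iff {n : ℕ} {I T S : Finset (Fin n)} :
    contraction I T S ≠ 0 ↔ ∃ i ∈ I, i ∉ T ∧ insert i T = S := by
  constructor
  · intro h
    rw [contraction, Matrix.sum_apply] at h
    obtain ⟨i, hi, h⟩ := Finset.exists_ne_zero_of_sum_ne_zero h
    refine ⟨i, hi, ?_⟩
    rw [annihilation_apply] at h
    by_contra h'
    exact h (if_neg h')
  · rintro ⟨i, hi, hT, rfl⟩
    rw [contraction_apply_insert hi hT]
    exact jwSign_ne_zero i T

lemma contraction_ne_zero_iff_of_subset {n : ℕ} {I T S : Finset (Fin n)} (hS : S ⊆ I) :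
    contraction I T S ≠ 0 ↔ T ⊆ S ∧ T.card + 1 = S.card := by
  rw [contraction_ne_zero_iff, ← Finset.exists_eq_insert_iff]
  constructor
  · rintro ⟨i, -, h⟩
    exact ⟨i, h⟩
  · rintro ⟨i, h1, h2⟩
    exact ⟨i, hS (h2 ▸ Finset.mem_insert_self i T), h1, h2⟩

lemma contraction_mul_transpose_mul_self {n : ℕ} (I : Finset (Fin n)) :
    contraction I * (contraction I)ᵀ * contraction I = (I.card : ℝ) • contraction I := by
  rw [eq_sub_of_add_eq (contraction_laplacian I), Matrix.sub_mul, Matrix.mul_assoc,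
    contraction_mul_self]
  simp

/-- Only `R = S ∩ T` can contribute to the inner product of the columns of the contraction at two
distinct sets `S`, `T` of equal size, so no cancellation occurs. -/
lemma contraction_gram_ne_zero_iff {n : ℕ} {I S T : Finset (Fin n)} (hS : S ⊆ I) (hT : T ⊆ I)
    (hcard : S.card = T.card) (hne : S ≠ T) :
    ((contraction I)ᵀ * contraction I) S T ≠ 0 ↔ (S ∩ T).card + 1 = S.card := by
  have hlt : (S ∩ T).card < S.card := Finset.card_lt_card <| by
    refine Finset.inter_subset_left.ssubset_of_ne fun h => hne ?_
    exact Finset.eq_of_subset_of_card_le (Finset.inter_eq_left.1 h) hcard.ge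
  rw [Matrix.mul_apply, Finset.sum_eq_single (S ∩ T)]
  · rw [Matrix.transpose_apply, mul_ne_zero_iff, contraction_ne_zero_iff_of_subset hS,
      contraction_ne_zero_iff_of_subset hT, ← hcard]
    simp
  · intro R _ hR
    by_contra h
    rw [← ne_eq, Matrix.transpose_apply, mul_ne_zero_iff, contraction_ne_zero_iff_of_subset hS,
      contraction_ne_zero_iff_of_subset hT] at h
    exact hR (Finset.eq_of_subset_of_card_le (Finset.subset_inter h.1.1 h.2.1) (by omega))
  · simp

/-- Acyclicity by coning at `w`: the kernel equation at `T \ {w}` contains the coordinate at `T`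
and otherwise only coordinates at sets avoiding `w`. -/
lemma eq_zero_of_contraction_mulVec_eq_zero {n : ℕ} {I : Finset (Fin n)} {w : Fin n} (hw : w ∈ I)
    {y : Finset (Fin n) → ℝ} (hy : contraction I *ᵥ y = 0) (h0 : ∀ T, w ∉ T → y T = 0) :
    y = 0 := by
  funext T
  by_cases hT : w ∈ T
  swap
  · exact h0 T hT
  have h := congrFun hy (T.erase w)
  rw [Matrix.mulVec, dotProduct, Finset.sum_eq_single T] at h
  · refine (mul_eq_zero.1 h).resolve_left ?_
    exact contraction_ne_zero_iff.2 ⟨w, hw, Finset.notMem_erase w T, Finset.insert_erase hT⟩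
  · intro S _ hS
    by_contra h'
    obtain ⟨h1, h2⟩ := mul_ne_zero_iff.1 h'
    obtain ⟨i, -, -, rfl⟩ := contraction_ne_zero_iff.1 h1
    refine h2 (h0 _ fun hmem => hS ?_)
    obtain rfl : w = i := by simpa using hmem
    exact Finset.insert_erase hT
  · simp

/-! ### Gram vectors for the Johnson graph -/

/-- The matrix whose column at a `d`-subset `S` is `D e_S` if `z ∉ S` and `D Dᵀ e_{S \ {z}}` if
`z ∈ S`, where `D` is the contraction by `∑ i ≠ z, e_i`. The rows are indexed by all subsets,
although only those of size `d - 1` avoiding `z` carry nonzero entries. -/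
def johnsonVectors (n d : ℕ) (z : Fin n) :
    Matrix (Finset (Fin n)) {S : Finset (Fin n) // S.card = d} ℝ :=
  Matrix.of fun R S =>
    if z ∈ S.1 then (contraction {z}ᶜ * (contraction {z}ᶜ)ᵀ) R (S.1.erase z)
    else contraction {z}ᶜ R S.1

lemma johnsonVectors_ne_zero {n d : ℕ} {z : Fin n} {R : Finset (Fin n)}
    {S : {S : Finset (Fin n) // S.card = d}} (h : johnsonVectors n d z R S ≠ 0) :
    z ∉ R ∧ R.card + 1 = d := by
  rw [johnsonVectors, Matrix.of_apply] at h
  split_ifs at h with hz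
  · rw [Matrix.mul_apply] at h
    obtain ⟨T, -, h⟩ := Finset.exists_ne_zero_of_sum_ne_zero h
    obtain ⟨h1, h2⟩ := mul_ne_zero_iff.1 h
    rw [Matrix.transpose_apply] at h2
    obtain ⟨i, hi, hiS, rfl⟩ := contraction_ne_zero_iff.1 h2
    have hiz : z ≠ i := fun h => by simp [h] at hi
    have hsub : insert i (S.1.erase z) ⊆ {z}ᶜ := by
      rw [Finset.subset_compl_singleton]
      simp [hiz]
    rw [contraction_ne_zero_iff_of_subset hsub, Finset.card_insert_of_notMem hiS,
      Finset.card_erase_add_one hz, S.2] at h1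
    exact ⟨fun hzR => by simpa using hsub (h1.1 hzR), h1.2⟩
  · rw [contraction_ne_zero_iff_of_subset (Finset.subset_compl_singleton.2 hz), S.2] at h
    exact ⟨fun hzR => hz (h.1 hzR), h.2⟩

lemma contraction_mul_johnsonVectors (n d : ℕ) (z : Fin n) :
    contraction {z}ᶜ * johnsonVectors n d z = 0 := by
  ext R S
  by_cases hz : z ∈ S.1
  · have h : (contraction {z}ᶜ * (contraction {z}ᶜ * (contraction {z}ᶜ)ᵀ)) R
        (S.1.erase z) = 0 := by
      rw [← Matrix.mul_assoc, contraction_mul_self]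
      simp
    simpa [Matrix.mul_apply, johnsonVectors, hz] using h
  · have h : (contraction {z}ᶜ * contraction {z}ᶜ) R S.1 = 0 := by
      rw [contraction_mul_self]
      rfl
    simpa [Matrix.mul_apply, johnsonVectors, hz] using h

lemma rank_johnsonVectors_le {n d : ℕ} {z w : Fin n} (hzw : z ≠ w) :
    (johnsonVectors n d z).rank ≤ (n - 2).choose (d - 1) := by
  let W := Finset.powersetCard (d - 1) ({z, w}ᶜ : Finset (Fin n))
  have hW : W.card = (n - 2).choose (d - 1) := by
    rw [Finset.card_powersetCard, Finset.card_compl, Fintype.card_fin, Finset.card_pair hzw]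
  -- Restriction of the coordinates to `W` is injective on the column space.
  let f : LinearMap.range (johnsonVectors n d z).mulVecLin →ₗ[ℝ] (W → ℝ) :=
    LinearMap.funLeft ℝ ℝ (Subtype.val : W → Finset (Fin n)) ∘ₗ Submodule.subtype _
  have hf : Function.Injective f := by
    rw [← LinearMap.ker_eq_bot, LinearMap.ker_eq_bot']
    rintro ⟨_, v, rfl⟩ hv
    rw [Subtype.ext_iff]
    refine eq_zero_of_contraction_mulVec_eq_zero (I := {z}ᶜ) (w := w) (by simpa using hzw.symm)
      ?_ fun T hwT => ?_
    · change contraction {z}ᶜ *ᵥ (johnsonVectors n d z *ᵥ v) = 0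
      rw [Matrix.mulVec_mulVec, contraction_mul_johnsonVectors, Matrix.zero_mulVec]
    · by_cases hT : T ∈ W
      · exact congrFun hv ⟨T, hT⟩
      · change (johnsonVectors n d z *ᵥ v) T = 0
        rw [Matrix.mulVec, dotProduct]
        refine Finset.sum_eq_zero fun S _ => ?_
        by_contra h
        obtain ⟨h1, h2⟩ := johnsonVectors_ne_zero (left_ne_zero_of_mul h)
        apply hT
        rw [Finset.mem_powersetCard]
        refine ⟨fun a ha => ?_, by omega⟩
        rw [Finset.mem_compl, Finset.mem_insert, Finset.mem_singleton]
        rintro (rfl | rfl)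
        exacts [h1 ha, hwT ha]
  calc (johnsonVectors n d z).rank ≤ Module.finrank ℝ (W → ℝ) :=
        LinearMap.finrank_le_finrank_of_injective hf
    _ = (n - 2).choose (d - 1) := by rw [Module.finrank_fintype_fun_eq_card, Fintype.card_coe, hW]

lemma johnsonVectors_gram_of_notMem {n d : ℕ} {z : Fin n}
    {S T : {S : Finset (Fin n) // S.card = d}} (hS : z ∉ S.1) (hT : z ∉ T.1) :
    ((johnsonVectors n d z)ᵀ * johnsonVectors n d z) S T =
      ((contraction {z}ᶜ)ᵀ * contraction {z}ᶜ) S.1 T.1 := by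
  rw [Matrix.mul_apply, Matrix.mul_apply]
  simp only [johnsonVectors, Matrix.transpose_apply, Matrix.of_apply, hS, hT, if_false]

lemma johnsonVectors_gram_of_mem_of_notMem {n d : ℕ} {z : Fin n}
    {S T : {S : Finset (Fin n) // S.card = d}} (hS : z ∈ S.1) (hT : z ∉ T.1) :
    ((johnsonVectors n d z)ᵀ * johnsonVectors n d z) S T =
      ((({z}ᶜ : Finset (Fin n)).card : ℝ) • contraction {z}ᶜ) (S.1.erase z) T.1 := by
  rw [← contraction_mul_transpose_mul_self, Matrix.mul_apply, Matrix.mul_apply]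
  refine Finset.sum_congr rfl fun R _ => ?_
  simp only [johnsonVectors, Matrix.transpose_apply, Matrix.of_apply, hS, hT, if_false, if_true]
  congr 1
  simp only [Matrix.mul_apply, Matrix.transpose_apply, mul_comm]

lemma johnsonVectors_gram_of_mem {n d : ℕ} {z : Fin n}
    {S T : {S : Finset (Fin n) // S.card = d}} (hS : z ∈ S.1) (hT : z ∈ T.1) :
    ((johnsonVectors n d z)ᵀ * johnsonVectors n d z) S T =
      ((({z}ᶜ : Finset (Fin n)).card : ℝ) • (contraction {z}ᶜ * (contraction {z}ᶜ)ᵀ))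
        (S.1.erase z) (T.1.erase z) := by
  rw [← Matrix.smul_mul, ← contraction_mul_transpose_mul_self, Matrix.mul_assoc, Matrix.mul_apply,
    Matrix.mul_apply]
  refine Finset.sum_congr rfl fun R _ => ?_
  simp only [johnsonVectors, Matrix.transpose_apply, Matrix.of_apply, hS, hT, if_true]
  congr 1
  simp only [Matrix.mul_apply, Matrix.transpose_apply, mul_comm]

lemma johnsonVectors_gram_mem_graphMatrices {n d : ℕ} (hn : 2 ≤ n) (z : Fin n) :
    (johnsonVectors n d z)ᵀ * johnsonVectors n d z ∈ graphMatrices (johnsonGraph n d) := by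
  set M := (johnsonVectors n d z)ᵀ * johnsonVectors n d z with hM
  have hsymm : M.IsSymm := by
    rw [hM, Matrix.IsSymm, Matrix.transpose_mul, Matrix.transpose_transpose]
  have hc : (({z}ᶜ : Finset (Fin n)).card : ℝ) ≠ 0 := by
    rw [Finset.card_compl, Fintype.card_fin, Finset.card_singleton, Nat.cast_ne_zero]
    omega
  have mixed : ∀ S T : {S : Finset (Fin n) // S.card = d}, z ∈ S.1 → z ∉ T.1 →
      (M S T ≠ 0 ↔ (S.1 ∩ T.1).card + 1 = d) := by
    intro S T hS hT
    have hd := Finset.card_erase_add_one hS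
    rw [S.2] at hd
    have hinter : S.1 ∩ T.1 = S.1.erase z ∩ T.1 := by
      rw [Finset.erase_inter, Finset.erase_eq_of_notMem]
      simp [hT]
    rw [hM, johnsonVectors_gram_of_mem_of_notMem hS hT, Matrix.smul_apply, smul_eq_mul,
      mul_ne_zero_iff, contraction_ne_zero_iff_of_subset (Finset.subset_compl_singleton.2 hT),
      T.2, hinter]
    constructor
    · rintro ⟨-, h1, h2⟩
      rwa [Finset.inter_eq_left.2 h1]
    · intro h
      refine ⟨hc, Finset.inter_eq_left.1 ?_, hd⟩
      exact Finset.eq_of_subset_of_card_le Finset.inter_subset_left (by omega)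
  refine ⟨hsymm, fun S T hST => ?_⟩
  rw [← not_iff_not, not_not, ← ne_eq]
  change M S T ≠ 0 ↔ (S.1 ∩ T.1).card + 1 = d
  have hST' : S.1 ≠ T.1 := fun h => hST (Subtype.ext h)
  by_cases hS : z ∈ S.1 <;> by_cases hT : z ∈ T.1
  · have hdS := Finset.card_erase_add_one hS
    have hdT := Finset.card_erase_add_one hT
    rw [S.2] at hdS
    rw [T.2] at hdT
    have hne : S.1.erase z ≠ T.1.erase z := fun h => hST' <| by
      rw [← Finset.insert_erase hS, h, Finset.insert_erase hT]
    have hinter : (S.1.erase z ∩ T.1.erase z).card + 1 = (S.1 ∩ T.1).card := by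
      rw [← Finset.card_erase_add_one (Finset.mem_inter.2 ⟨hS, hT⟩)]
      congr 2
      ext a
      simp only [Finset.mem_inter, Finset.mem_erase]
      tauto
    rw [hM, johnsonVectors_gram_of_mem hS hT, eq_sub_of_add_eq (contraction_laplacian {z}ᶜ),
      Matrix.smul_apply, Matrix.sub_apply, Matrix.smul_apply, Matrix.one_apply_ne hne, smul_zero,
      zero_sub, smul_neg, neg_ne_zero, smul_ne_zero_iff,
      contraction_gram_ne_zero_iff (by simp) (by simp) (by omega) hne]
    simp only [hc, ne_eq, not_false_eq_true, true_and]
    omega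
  · exact mixed S T hS hT
  · rw [← hsymm.apply S T, mixed T S hT hS, Finset.inter_comm]
  · rw [hM, johnsonVectors_gram_of_notMem hS hT, contraction_gram_ne_zero_iff
      (Finset.subset_compl_singleton.2 hS) (Finset.subset_compl_singleton.2 hT)
      (S.2.trans T.2.symm) hST', S.2]

/-! ### The lower bound -/

/-- The rows `T ∪ {z}` and columns `T ∪ {w}`, for `(d - 1)`-sets `T` avoiding `z` and `w`, form a
diagonal submatrix with nonzero diagonal. -/
lemma choose_le_rank_of_mem_graphMatrices {n d : ℕ} (hd : 1 ≤ d) {z w : Fin n} (hzw : z ≠ w)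
    {M : Matrix {S : Finset (Fin n) // S.card = d} {S : Finset (Fin n) // S.card = d} ℝ}
    (hM : M ∈ graphMatrices (johnsonGraph n d)) : (n - 2).choose (d - 1) ≤ M.rank := by
  classical
  let W := Finset.powersetCard (d - 1) ({z, w}ᶜ : Finset (Fin n))
  have hW : W.card = (n - 2).choose (d - 1) := by
    rw [Finset.card_powersetCard, Finset.card_compl, Fintype.card_fin, Finset.card_pair hzw]
  have hmem : ∀ T : W, z ∉ T.1 ∧ w ∉ T.1 ∧ T.1.card + 1 = d := fun T => by
    obtain ⟨h1, h2⟩ := Finset.mem_powersetCard.1 T.2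
    refine ⟨fun h => ?_, fun h => ?_, by omega⟩
    · simpa using h1 h
    · simpa using h1 h
  let r : W → {S : Finset (Fin n) // S.card = d} := fun T =>
    ⟨insert z T.1, by rw [Finset.card_insert_of_notMem (hmem T).1, (hmem T).2.2]⟩
  let c : W → {S : Finset (Fin n) // S.card = d} := fun T =>
    ⟨insert w T.1, by rw [Finset.card_insert_of_notMem (hmem T).2.1, (hmem T).2.2]⟩
  have hrc : ∀ T U : W, M (r T) (c U) ≠ 0 ↔ T = U := fun T U => by
    have hne : r T ≠ c U := fun h => by
      have : z ∈ (c U).1 := h ▸ Finset.mem_insert_self z T.1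
      exact (Finset.mem_insert.1 this).elim hzw (hmem U).1
    have hinter : (r T).1 ∩ (c U).1 = T.1 ∩ U.1 := by
      ext a
      have := hmem T
      have := hmem U
      simp only [r, c, Finset.mem_inter, Finset.mem_insert]
      grind
    rw [ne_eq, hM.2 _ _ hne, not_not]
    change ((r T).1 ∩ (c U).1).card + 1 = d ↔ T = U
    have hT := (hmem T).2.2
    have hU := (hmem U).2.2
    rw [hinter]
    constructor
    · intro h
      have h1 := Finset.eq_of_subset_of_card_le (Finset.inter_subset_left (s₁ := T.1) (s₂ := U.1))
        (by omega)
      exact Subtype.ext (Finset.eq_of_subset_of_card_le (Finset.inter_eq_left.1 h1) (by omega))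
    · rintro rfl
      rw [Finset.inter_self, hT]
  have hdiag : M.submatrix r c = Matrix.diagonal fun T => M (r T) (c T) := by
    ext T U
    rcases eq_or_ne T U with rfl | h
    · simp
    · rw [Matrix.diagonal_apply_ne _ h]
      by_contra h'
      exact h ((hrc T U).1 h')
  calc (n - 2).choose (d - 1) = Fintype.card W := by rw [Fintype.card_coe, hW]
    _ = Fintype.card {T : W // M (r T) (c T) ≠ 0} :=
      (Fintype.card_congr (Equiv.subtypeUnivEquiv fun T => (hrc T T).2 rfl)).symm
    _ = (M.submatrix r c).rank := by rw [hdiag, Matrix.rank_diagonal]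
    _ ≤ M.rank := Matrix.rank_submatrix_le M r c

/-! ### The minimum ranks -/

theorem theorem5p2 (n d : ℕ) (hd : 2 ≤ d) (hn : 2 * d ≤ n) :
    minRank (johnsonGraph n d) = (n - 2).choose (d - 1) ∧
      minRankPSD (johnsonGraph n d) = (n - 2).choose (d - 1) := by
  obtain ⟨z, w, hzw⟩ : ∃ z w : Fin n, z ≠ w :=
    ⟨⟨0, by omega⟩, ⟨1, by omega⟩, by simp⟩
  have hlow {M : Matrix _ _ ℝ} (hM : M ∈ graphMatrices (johnsonGraph n d)) :
      (n - 2).choose (d - 1) ≤ M.rank :=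
    choose_le_rank_of_mem_graphMatrices (by omega) hzw hM
  let X := johnsonVectors n d z
  have hmem : Xᵀ * X ∈ graphMatrices (johnsonGraph n d) :=
    johnsonVectors_gram_mem_graphMatrices (by omega) z
  have hpsd : (Xᵀ * X).PosSemidef := by
    simpa using Matrix.posSemidef_conjTranspose_mul_self X
  have hrank : (Xᵀ * X).rank = (n - 2).choose (d - 1) :=
    le_antisymm ((Matrix.rank_transpose_mul_self X).trans_le (rank_johnsonVectors_le hzw))
      (hlow hmem)
  constructor
  · refine le_antisymm (Nat.sInf_le ⟨_, hmem, hrank⟩) (le_csInf ⟨_, _, hmem, hrank⟩ ?_)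
    rintro _ ⟨M, hM, rfl⟩
    exact hlow hM
  · refine le_antisymm (Nat.sInf_le ⟨_, hmem, hpsd, hrank⟩)
      (le_csInf ⟨_, _, hmem, hpsd, hrank⟩ ?_)
    rintro _ ⟨M, hM, -, rfl⟩
    exact hlow hM
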